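/- Let $S$ be a set and let $(m_{\sigma,\tau})_{\sigma,\tau\in S}$ be a Coxeter matrix. Let $A^+$ and $A$ be the Artin–Tits monoid and the Artin–Tits group, presented by the generators $S$ and the relations $\sigma\tau\sigma\cdots=\tau\sigma\tau\cdots$ ($m_{\sigma,\tau}$ factors on each side) for $\sigma\ne\tau$ in $S$ with $m_{\sigma,\tau}<\infty$. Assume that $A^+$ is of spherical type, i.e. that the associated Coxeter group $W$ is finite. Let $\Delta\in A^+$ be the image of the longest element of $W$ under the canonical section $W\to A^+$, which sends $w\in W$ to the element of $A^+$ represented by any reduced expression of $w$. Call a positive word (a word on $S$) simple if the element of $A^+$ that it represents is a divisor of $\Delta$. Two words on $S\cup S^{-1}$ are called equivalent, written $\equiv$, if they represent the same element of $A$, and a word is trivial if it represents $1$. A word of the form $\sigma^{e}w'\tau^{-e}$ with $\sigma,\tau\in S$, $e=\pm1$ and $w'$ a word on $S\cup S^{-1}$ is called a removable pair of letters if $\sigma^{e}w'\tau^{-e}\equiv w'$. Then every nonempty trivial word $w$ of the form $u^{-1}v$, with $u$ and $v$ simple positive words, contains at least one removable pair of letters; that is, some subword of consecutive letters of $w$ is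 a removable pair of letters. -/

import Mathlib

namespace ArtinTits

/-! ### The Artin-Tits monoid and the Artin-Tits group of a Coxeter matrix

The letters are the elements of `B`. As usual for `CoxeterMatrix`, the entry `0` stands for `∞`;
then both braid words are empty and the corresponding braid relation is void. -/

/-- The braid relations `σ τ σ ⋯ = τ σ τ ⋯` (with `M σ τ` factors on both sides), for `σ ≠ τ`,
as a relation on positive words. The word `CoxeterSystem.braidWord M σ τ` is the alternating word
in `σ` and `τ` of length `M σ τ` with last letter `τ`. -/
inductive BraidRel {B : Type*} (M : CoxeterMatrix B) : FreeMonoid B → FreeMonoid B → Prop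
  | braid (σ τ : B) (h : σ ≠ τ) :
      BraidRel M (FreeMonoid.ofList (CoxeterSystem.braidWord M σ τ))
        (FreeMonoid.ofList (CoxeterSystem.braidWord M τ σ))

/-- The Artin-Tits monoid: the monoid presented by the generators `B` and the braid relations. -/
abbrev ArtinMonoid {B : Type*} (M : CoxeterMatrix B) : Type _ :=
  PresentedMonoid (BraidRel M)

/-- The element of the Artin-Tits monoid represented by a positive word. -/
def monoidEval {B : Type*} (M : CoxeterMatrix B) (u : List B) : ArtinMonoid M :=
  PresentedMonoid.mk (BraidRel M) (FreeMonoid.ofList u)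

/-- The element of the free group represented by a positive word. -/
def freeGroupEval {B : Type*} (u : List B) : FreeGroup B :=
  (u.map FreeGroup.of).prod

/-- The braid relators, elements of the free group on `B`. -/
def braidRelators {B : Type*} (M : CoxeterMatrix B) : Set (FreeGroup B) :=
  {r | ∃ σ τ : B, σ ≠ τ ∧
    r = freeGroupEval (CoxeterSystem.braidWord M σ τ) *
      (freeGroupEval (CoxeterSystem.braidWord M τ σ))⁻¹}

/-- The Artin-Tits group: the group presented by the generators `B` and the braid relations. -/
abbrev ArtinGroup {B : Type*} (M : CoxeterMatrix B) : Type _ :=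
  PresentedGroup (braidRelators M)

/-! ### Words on the letters `σ` and `σ⁻¹`

A word is a list over `B × Bool`, as for Mathlib's free groups: `(σ, true)` is the letter `σ` and
`(σ, false)` is the letter `σ⁻¹`. No reduction is performed on words. -/

/-- The element of the Artin-Tits group represented by a word. -/
def groupEval {B : Type*} (M : CoxeterMatrix B) (w : List (B × Bool)) : ArtinGroup M :=
  PresentedGroup.mk (braidRelators M) (FreeGroup.mk w)

/-- Two words are equivalent if they represent the same element of the Artin-Tits group. -/
def WordEquiv {B : Type*} (M : CoxeterMatrix B) (w w' : List (B × Bool)) : Prop :=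
  groupEval M w = groupEval M w'

/-- A word is trivial if it is equivalent to the empty word. -/
def IsTrivialWord {B : Type*} (M : CoxeterMatrix B) (w : List (B × Bool)) : Prop :=
  WordEquiv M w []

/-- A positive word, seen as a word. -/
def posWord {B : Type*} (u : List B) : List (B × Bool) :=
  u.map fun σ => (σ, true)

/-- The word `u⁻¹ v`, for positive words `u` and `v`. -/
def negPosWord {B : Type*} (u v : List B) : List (B × Bool) :=
  FreeGroup.invRev (posWord u) ++ posWord v

/-- A word `σ^e w τ^{-e}`, with letters `σ`, `τ` and `e = ± 1`, is a removable pair of letters if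
it is equivalent to `w`. -/
def IsRemovablePair {B : Type*} (M : CoxeterMatrix B) (x : List (B × Bool)) : Prop :=
  ∃ (σ τ : B) (e : Bool) (w : List (B × Bool)),
    x = (σ, e) :: (w ++ [(τ, !e)]) ∧ WordEquiv M x w

/-- A word contains a removable pair of letters if one of its (contiguous) subwords is one. -/
def ContainsRemovablePair {B : Type*} (M : CoxeterMatrix B) (w : List (B × Bool)) : Prop :=
  ∃ x : List (B × Bool), x <:+: w ∧ IsRemovablePair M x

/-! ### The fundamental element `Δ` and simple words -/

/-- `w` is a longest element of the Coxeter group. -/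
def IsLongest {B : Type*} (M : CoxeterMatrix B) (w : M.Group) : Prop :=
  ∀ w' : M.Group, M.toCoxeterSystem.length w' ≤ M.toCoxeterSystem.length w

/-- `x` is the image of `w` under the canonical section of the projection of the Artin-Tits monoid
onto the Coxeter group: it is represented by a reduced expression of `w`. -/
def IsCanonicalLift {B : Type*} (M : CoxeterMatrix B) (w : M.Group) (x : ArtinMonoid M) : Prop :=
  ∃ ω : List B, M.toCoxeterSystem.IsReduced ω ∧ M.toCoxeterSystem.wordProd ω = w ∧
    monoidEval M ω = x

/-- `d` is the element `Δ`: the image of the longest element of the Coxeter group under the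
canonical section. -/
def IsDelta {B : Type*} (M : CoxeterMatrix B) (d : ArtinMonoid M) : Prop :=
  ∃ w : M.Group, IsLongest M w ∧ IsCanonicalLift M w d

/-- The simple elements are the divisors of `Δ`. (In a noncommutative monoid, `x ∣ d` says that
`x` is a left divisor of `d`; the left and the right divisors of `Δ` coincide.) -/
def IsSimpleElement {B : Type*} (M : CoxeterMatrix B) (x : ArtinMonoid M) : Prop :=
  ∃ d : ArtinMonoid M, IsDelta M d ∧ x ∣ d

/-- A positive word is simple if it represents a simple element. -/
def IsSimpleWord {B : Type*} (M : CoxeterMatrix B) (u : List B) : Prop :=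
  IsSimpleElement M (monoidEval M u)

end ArtinTits

/-! Triviality of `u⁻¹ v` gives `u` and `v` the same image in the Coxeter group `W`, and simple
words are reduced (`IsSimpleWord.isReduced`). So the first letter `σ` of `u` is a left descent of
the image of `v`, and the exchange property yields a prefix `v' τ` of `v` with `σ v' = v' τ` in `W`.
Both sides are reduced, so Matsumoto's theorem (`monoidEval_eq_of_isReduced`) lifts the equality to
the monoid, hence to the group, where it reads `σ⁻¹ v' τ ≡ v'`. This is a subword of `u⁻¹ v`,
because `u⁻¹` ends in `σ⁻¹`.

The exchange property comes from an action of `W` on `W × ZMod 2` that records parities in inversion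
sequences. Matsumoto's theorem also needs `σ τ` to have order exactly `M σ τ` in `W`; the geometric
representation supplies this. -/

/-! ### The exchange property -/

namespace CoxeterSystem

open List

variable {B W : Type*} [Group W] {M : CoxeterMatrix B} (cs : CoxeterSystem M W)

open Classical in
/-- The permutation of `W × ZMod 2` that conjugates the first coordinate by a simple reflection
and flips the second one exactly when the first one is this simple reflection. -/
noncomputable def flipPerm (i : B) : Equiv.Perm (W × ZMod 2) :=
  Function.Involutive.toPerm
    (fun p ↦ (cs.simple i * p.1 * cs.simple i, p.2 + if p.1 = cs.simple i then 1 else 0)) <| by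
      rintro ⟨x, ε⟩
      have h : cs.simple i * x * cs.simple i = cs.simple i ↔ x = cs.simple i := by
        rw [mul_eq_right, mul_eq_one_iff_eq_inv', cs.inv_simple]
      ext
      · simp [mul_assoc]
      · simp only [h, add_assoc]
        split_ifs <;> simp [CharTwo.add_self_eq_zero]

open Classical in
theorem flipPerm_apply (i : B) (p : W × ZMod 2) :
    cs.flipPerm i p =
      (cs.simple i * p.1 * cs.simple i, p.2 + if p.1 = cs.simple i then 1 else 0) := rfl

open Classical in
theorem prod_map_flipPerm_apply (ω : List B) (p : W × ZMod 2) :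
    (ω.map cs.flipPerm).prod p =
      (cs.wordProd ω * p.1 * (cs.wordProd ω)⁻¹, p.2 + (cs.rightInvSeq ω).count p.1) := by
  induction ω with
  | nil => simp
  | cons i ω ih =>
    have h : cs.wordProd ω * p.1 * (cs.wordProd ω)⁻¹ = cs.simple i ↔
        (cs.wordProd ω)⁻¹ * cs.simple i * cs.wordProd ω = p.1 := by
      constructor <;> intro h
      · rw [← h]; group
      · rw [← h]; group
    rw [map_cons, prod_cons, Equiv.Perm.mul_apply, ih, flipPerm_apply]
    ext
    · simp [wordProd_cons, mul_assoc]
    · simp only [rightInvSeq, count_cons, beq_iff_eq, h, Nat.cast_add, add_assoc]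
      split_ifs <;> simp

theorem prod_map_alternatingWord {G : Type*} [Monoid G] (f : B → G) (i j : B) (p : ℕ) :
    ((alternatingWord i j (2 * p)).map f).prod = (f i * f j) ^ p := by
  induction p with
  | zero => simp [alternatingWord]
  | succ p ih =>
    rw [show 2 * (p + 1) = 2 * p + 1 + 1 by ring, alternatingWord_succ, alternatingWord_succ]
    simp [ih, pow_succ]

theorem reverse_alternatingWord (i j : B) (p : ℕ) :
    (alternatingWord i j (2 * p)).reverse = alternatingWord j i (2 * p) := by
  induction p with
  | zero => simp [alternatingWord]
  | succ p ih =>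
    rw [show 2 * (p + 1) = 2 * p + 1 + 1 by ring, alternatingWord_succ, alternatingWord_succ,
      alternatingWord_succ', alternatingWord_succ']
    simp [ih]

-- Since `(s i * s j) ^ M i j = 1`, the inversion sequence has period `M i j`, so its two halves
-- coincide.
open Classical in
theorem even_count_leftInvSeq_alternatingWord (i j : B) (x : W) :
    Even ((cs.leftInvSeq (alternatingWord i j (2 * M i j))).count x) := by
  set m := M i j with hm
  set L := cs.leftInvSeq (alternatingWord i j (2 * m)) with hL
  have hlen : L.length = 2 * m := by simp [hL]
  have h : L.drop m = L.take m := by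
    apply List.ext_getElem
    · simp [hlen]; omega
    · intro k h₁ h₂
      simp only [getElem_drop, getElem_take]
      simp only [length_drop, hlen] at h₁
      rw [cs.getElem_leftInvSeq_alternatingWord i j m _ (by omega),
        cs.getElem_leftInvSeq_alternatingWord i j m _ (by omega)]
      simp only [prod_alternatingWord_eq_mul_pow]
      have e₁ : (2 * (m + k) + 1) / 2 = m + k := by omega
      have e₂ : (2 * k + 1) / 2 = k := by omega
      rw [e₁, e₂, pow_add, hm, cs.simple_mul_simple_pow']
      simp
  rw [← List.take_append_drop m L, h, count_append]
  exact ⟨_, rfl⟩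

theorem flipPerm_isLiftable : M.IsLiftable cs.flipPerm := by
  classical
  intro i j
  ext1 p
  rw [← prod_map_alternatingWord, prod_map_flipPerm_apply]
  have h : cs.wordProd (alternatingWord i j (2 * M i j)) = 1 := by
    rw [wordProd, prod_map_alternatingWord, cs.simple_mul_simple_pow]
  have h' : Even ((cs.rightInvSeq (alternatingWord i j (2 * M i j))).count p.1) := by
    rw [← reverse_alternatingWord, rightInvSeq_reverse, count_reverse, M.symmetric i j]
    exact cs.even_count_leftInvSeq_alternatingWord j i p.1
  rw [h]
  ext
  · simp
  · simpa using (ZMod.natCast_eq_zero_iff_even).mpr h'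

-- The flips define an action of `W`, so the parity read off the second coordinate depends only on
-- the group element.
open Classical in
theorem count_rightInvSeq_eq_of_wordProd_eq {ω ω' : List B}
    (h : cs.wordProd ω = cs.wordProd ω') (x : W) :
    ((cs.rightInvSeq ω).count x : ZMod 2) = (cs.rightInvSeq ω').count x := by
  have key (ω : List B) :
      cs.lift ⟨cs.flipPerm, cs.flipPerm_isLiftable⟩ (cs.wordProd ω) =
        (ω.map cs.flipPerm).prod := by
    rw [wordProd, map_list_prod, map_map]
    congr 2
    ext1 i
    exact cs.lift_apply_simple cs.flipPerm_isLiftable i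
  have := congrArg (fun σ : Equiv.Perm (W × ZMod 2) ↦ (σ (x, 0)).2)
    ((key ω).symm.trans (h ▸ key ω'))
  simpa [prod_map_flipPerm_apply] using this

/-- The exchange property. -/
theorem simple_mem_rightInvSeq {ω : List B} {i : B}
    (h : cs.IsRightDescent (cs.wordProd ω) i) : cs.simple i ∈ cs.rightInvSeq ω := by
  classical
  -- Appending `i` to a reduced word of `w s_i` gives a reduced word of `w`, in whose inversion
  -- sequence `s_i` occurs exactly once; the odd parity passes to `ω`.
  obtain ⟨ω', hω', hprod⟩ := cs.exists_isReduced (cs.wordProd ω * cs.simple i)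
  have hprod' : cs.wordProd ω = cs.wordProd (ω'.concat i) := by
    rw [wordProd_concat, ← hprod, simple_mul_simple_cancel_right]
  have hred : cs.IsReduced (ω'.concat i) := by
    have := cs.isRightDescent_iff.mp h
    rw [IsReduced, ← hprod', ← this, hprod, hω'.eq]
    simp
  have hmem : cs.simple i ∈ cs.rightInvSeq (ω'.concat i) := by
    rw [rightInvSeq_concat]; simp
  have hcount := cs.count_rightInvSeq_eq_of_wordProd_eq hprod' (cs.simple i)
  rw [List.count_eq_one_of_mem hred.nodup_rightInvSeq hmem] at hcount
  by_contra hcon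
  rw [List.count_eq_zero_of_not_mem hcon] at hcount
  simp at hcount

theorem simple_mem_leftInvSeq {ω : List B} {i : B}
    (h : cs.IsLeftDescent (cs.wordProd ω) i) : cs.simple i ∈ cs.leftInvSeq ω := by
  rw [← isRightDescent_inv_iff, ← wordProd_reverse] at h
  simpa [rightInvSeq_reverse] using cs.simple_mem_rightInvSeq h

theorem exists_simple_mul_wordProd_take {ω : List B} {i : B}
    (h : cs.IsLeftDescent (cs.wordProd ω) i) :
    ∃ j < ω.length, cs.simple i * cs.wordProd (ω.take j) = cs.wordProd (ω.take (j + 1)) := by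
  obtain ⟨j, hj, e⟩ := List.mem_iff_getElem.mp (cs.simple_mem_leftInvSeq h)
  rw [length_leftInvSeq] at hj
  refine ⟨j, hj, ?_⟩
  rw [cs.getElem_leftInvSeq ω j hj] at e
  rw [← e, ← List.take_concat_get' ω j hj, wordProd_append]
  simp

end CoxeterSystem

/-! ### The geometric representation and the order of `s i * s j` -/

namespace CoxeterMatrix

open Real Module Polynomial.Chebyshev

variable {B : Type*} (M : CoxeterMatrix B)

/-- The coroot of `i`, with value `-2 cos (π / M i j)` at the simple root of `j`. -/
noncomputable def coroot (i : B) : Dual ℝ (B →₀ ℝ) :=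
  Finsupp.linearCombination ℝ fun j ↦ -2 * cos (π / M i j)

theorem coroot_single (i j : B) :
    M.coroot i (Finsupp.single j 1) = -2 * cos (π / M i j) := by
  simp [coroot]

theorem coroot_single_self (i : B) : M.coroot i (Finsupp.single i 1) = 2 := by
  simp [coroot_single]

/-- The reflection of the geometric representation attached to `i`. -/
noncomputable def geomReflection (i : B) : (B →₀ ℝ) ≃ₗ[ℝ] (B →₀ ℝ) :=
  reflection (M.coroot_single_self i)

theorem coroot_mul_coroot_sub_two (i j : B) :
    2 * cos (2 * (π / M i j)) =
      M.coroot i (Finsupp.single j 1) * M.coroot j (Finsupp.single i 1) - 2 := by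
  rw [coroot_single, coroot_single, M.symmetric j i, cos_two_mul]
  ring

theorem sin_two_mul_pi_div_pos {m : ℕ} (hm : 3 ≤ m) : 0 < sin (2 * (π / m)) := by
  have hm' : (3 : ℝ) ≤ m := by exact_mod_cast hm
  apply sin_pos_of_pos_of_lt_pi
  · have := pi_pos; positivity
  · rw [← mul_div_assoc, div_lt_iff₀ (by linarith)]
    nlinarith [pi_pos]

/-- With `θ = 2π/m`, `S n (2 cos θ) * sin θ = sin ((n + 1) θ)`, and `sin θ ≠ 0` for `m ≥ 3`. The
first alternative gives `sin π`; in the second, two sines cancel. Such products are the coefficients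
in the formula for powers of a product of two reflections. -/
theorem S_mul_S_add_S_eval_eq_zero {m : ℕ} (hm : 3 ≤ m) {a b c : ℤ}
    (h : 2 * (a + 1) = m ∨ (b + 1) + (c + 1) = m) :
    (S ℝ a).eval (2 * cos (2 * (π / m))) *
      ((S ℝ b).eval (2 * cos (2 * (π / m))) + (S ℝ c).eval (2 * cos (2 * (π / m)))) = 0 := by
  have hs := sin_two_mul_pi_div_pos hm
  have hm0 : (m : ℝ) ≠ 0 := by positivity
  rw [mul_eq_zero]
  rcases h with h | h
  · left
    apply (mul_eq_zero_iff_right hs.ne').mp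
    rw [S_two_mul_real_cos]
    have h' : (2 : ℝ) * (a + 1) = m := by exact_mod_cast h
    have : ((a : ℝ) + 1) * (2 * (π / m)) = π := by
      field_simp; linear_combination h'
    rw [this]
    exact sin_pi
  · right
    apply (mul_eq_zero_iff_right hs.ne').mp
    rw [add_mul, S_two_mul_real_cos, S_two_mul_real_cos]
    have h' : ((b : ℝ) + 1) + (c + 1) = m := by exact_mod_cast h
    have : ((b : ℝ) + 1) * (2 * (π / m)) = 2 * π - (c + 1) * (2 * (π / m)) := by
      field_simp; linear_combination h'
    rw [this, sin_two_pi_sub]; ring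

theorem geomReflection_isLiftable : M.IsLiftable M.geomReflection := by
  intro i j
  rcases eq_or_ne i j with rfl | hij
  · rw [M.diagonal, pow_one]
    ext1 z
    exact involutive_reflection (M.coroot_single_self i) z
  have h1 := M.off_diagonal i j hij
  rcases lt_or_ge (M i j) 3 with hlt | hge
  · interval_cases hm : M i j
    · simp
    · simp at h1
    · have e₁ : M.coroot i (Finsupp.single j 1) = 0 := by simp [coroot_single, hm]
      have e₂ : M.coroot j (Finsupp.single i 1) = 0 := by
        simp [coroot_single, M.symmetric j i, hm]
      ext1 z
      simp only [pow_two, LinearEquiv.mul_apply, geomReflection, reflection_apply, map_sub,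
        map_smul, e₁, e₂, coroot_single_self, LinearEquiv.coe_one, id_eq]
      module
  · apply LinearEquiv.ext
    intro z
    rw [geomReflection, geomReflection, reflection_mul_reflection_pow_apply _ _ _ _ _
      (M.coroot_mul_coroot_sub_two i j), S_mul_S_add_S_eval_eq_zero hge (by omega),
      S_mul_S_add_S_eval_eq_zero hge (by omega)]
    simp

/-- The two coordinates of the image of the simple root of `i` are Chebyshev values; for `M i j ≥ 3`
they force `q * (2π / M i j)` to be a multiple of `2π`. -/
theorem dvd_of_geomReflection_pow_eq_one {i j : B} (hij : i ≠ j) {q : ℕ}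
    (h : (M.geomReflection i * M.geomReflection j) ^ q = 1) : M i j ∣ q := by
  have h1 := M.off_diagonal i j hij
  have hx := congrArg (fun f : (B →₀ ℝ) ≃ₗ[ℝ] (B →₀ ℝ) ↦ f (Finsupp.single i 1)) h
  simp only [geomReflection, reflection_mul_reflection_pow_apply_self _ _ _ _
    (M.coroot_mul_coroot_sub_two i j), LinearEquiv.coe_one, id_eq] at hx
  have hi := congrArg (fun v : B →₀ ℝ ↦ v i) hx
  have hj := congrArg (fun v : B →₀ ℝ ↦ v j) hx
  simp only [Finsupp.add_apply, Finsupp.smul_apply, Finsupp.single_eq_same, smul_eq_mul,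
    Finsupp.single_eq_of_ne hij, Finsupp.single_eq_of_ne hij.symm, mul_zero, mul_one, add_zero,
    zero_add, coroot_single, M.symmetric j i] at hi hj
  rcases lt_or_ge (M i j) 3 with hlt | hge
  · interval_cases hm : M i j
    -- Here `π / 0 = 0`, so the parameter is `2`, and `S (q - 1)` takes the value `q` there: thus `q
    -- = 0`.
    · simp [S_eval_two] at hj
      simp [hj]
    · simp at h1
    · have : 2 * cos (2 * (π / (2 : ℕ))) = -2 := by
        rw [Nat.cast_ofNat, mul_div_cancel₀ _ two_ne_zero, cos_pi]; norm_num
      rw [this, S_eval_neg_two, S_eval_neg_two] at hi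
      rw [← even_iff_two_dvd]
      by_contra hq
      rw [Nat.not_even_iff_odd] at hq
      rw [Int.negOnePow_odd _ (by exact_mod_cast hq), Int.negOnePow_even _ (by
        have := hq.natCast (R := ℤ); exact this.sub_odd odd_one)] at hi
      push_cast at hi
      linarith
  · have hs := sin_two_mul_pi_div_pos hge
    have hm0 : (M i j : ℝ) ≠ 0 := by positivity
    have hc : cos (π / M i j) ≠ 0 := by
      intro hc
      rw [sin_two_mul, hc] at hs
      simp at hs
    have hS : (S ℝ ((q : ℤ) - 1)).eval (2 * cos (2 * (π / M i j))) = 0 := by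
      simpa [hc] using hj
    rw [hS, add_zero] at hi
    have e₁ := S_two_mul_real_cos (2 * (π / M i j)) ((q : ℤ) - 1)
    have e₂ := S_two_mul_real_cos (2 * (π / M i j)) q
    rw [hS] at e₁
    rw [hi] at e₂
    push_cast at e₁ e₂
    rw [zero_mul, sub_add_cancel] at e₁
    rw [add_mul, one_mul, one_mul, sin_add, ← e₁, zero_mul, zero_add] at e₂
    have hcos : cos (q * (2 * (π / M i j))) = 1 := by
      apply mul_right_cancel₀ hs.ne'
      rw [one_mul]; exact e₂.symm
    obtain ⟨n, hn⟩ := (cos_eq_one_iff _).mp hcos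
    have : (n * M i j : ℝ) = q := by
      field_simp at hn
      have := pi_pos
      nlinarith
    have : n * (M i j : ℤ) = q := by exact_mod_cast this
    exact Int.natCast_dvd_natCast.mp ⟨n, by rw [← this]; ring⟩

end CoxeterMatrix

theorem CoxeterSystem.dvd_of_simple_mul_simple_pow_eq_one {B W : Type*} [Group W]
    {M : CoxeterMatrix B} (cs : CoxeterSystem M W) {i j : B} (hij : i ≠ j) {q : ℕ}
    (h : (cs.simple i * cs.simple j) ^ q = 1) : M i j ∣ q := by
  apply M.dvd_of_geomReflection_pow_eq_one hij
  have := congrArg (cs.lift ⟨M.geomReflection, M.geomReflection_isLiftable⟩) h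
  simpa using this

/-! ### Matsumoto's theorem -/

namespace CoxeterSystem

open List

variable {B W : Type*} [Group W] {M : CoxeterMatrix B} (cs : CoxeterSystem M W)

theorem take_alternatingWord_add (i j : B) (n d : ℕ) :
    (alternatingWord i j (n + d)).take n =
      if Even d then alternatingWord i j n else alternatingWord j i n := by
  induction d generalizing i j with
  | zero => simp
  | succ d ih =>
    rw [← add_assoc, alternatingWord_succ, List.concat_eq_append,
      List.take_append_of_le_length (by simp), ih]
    by_cases hd : Even d <;> simp [hd, Nat.even_add_one]

theorem simple_mul_simple_pow_eq_one_of_wordProd_eq {i j : B} {q : ℕ}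
    (h : cs.wordProd (alternatingWord i j q) = cs.wordProd (alternatingWord j i q)) :
    (cs.simple i * cs.simple j) ^ q = 1 := by
  have hinv (r : ℕ) :
      (cs.simple j * cs.simple i) ^ r = ((cs.simple i * cs.simple j) ^ r)⁻¹ := by
    rw [← inv_pow]; simp
  simp only [prod_alternatingWord_eq_mul_pow] at h
  obtain ⟨r, rfl | rfl⟩ := Nat.even_or_odd' q
  · simp only [even_two_mul, if_true, one_mul, Nat.mul_div_cancel_left r two_pos, hinv] at h
    rw [two_mul, pow_add]
    nth_rw 1 [h]
    exact inv_mul_cancel _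
  · have e : (2 * r + 1) / 2 = r := by omega
    simp only [Nat.not_even_bit1, if_false, e, hinv] at h
    rw [pow_succ', two_mul, pow_add, mul_assoc, ← mul_assoc (cs.simple j), h]
    simp

/-- A word for `w` of minimal length is reduced. -/
theorem IsReduced.of_wordProd_eq {cs : CoxeterSystem M W} {ω ω' : List B} (hω : cs.IsReduced ω)
    (h : cs.wordProd ω' = cs.wordProd ω) (hlen : ω'.length = ω.length) : cs.IsReduced ω' := by
  rw [IsReduced, h, hlen]
  exact hω

/-- Exchange prepends `i` and `j` alternately to a reduced word of `w`. As long as the deleted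
letter lies in the tail, the alternating prefix grows, which the length of `w` bounds. -/
theorem exists_isReduced_braidWord_append {i j : B} (hij : i ≠ j) {w : W}
    (hi : cs.IsLeftDescent w i) (hj : cs.IsLeftDescent w j) :
    M i j ≠ 0 ∧ ∃ c, cs.wordProd (braidWord M i j ++ c) = w ∧
      cs.IsReduced (braidWord M i j ++ c) := by
  by_contra hcon
  have key (k : ℕ) : ∃ c, cs.wordProd (alternatingWord i j k ++ c) = w ∧
      cs.IsReduced (alternatingWord i j k ++ c) := by
    induction k with
    | zero =>
      obtain ⟨c, hc, rfl⟩ := cs.exists_isReduced w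
      exact ⟨c, rfl, hc⟩
    | succ k ih =>
      obtain ⟨c, hw, hred⟩ := ih
      have hx : cs.IsLeftDescent w (if Even k then j else i) := by split_ifs <;> assumption
      rw [← hw] at hx
      obtain ⟨n, hn, e⟩ := cs.exists_simple_mul_wordProd_take hx
      rcases le_or_gt k n with hkn | hkn
      · have htake : (alternatingWord i j k ++ c).take n =
            alternatingWord i j k ++ c.take (n - k) := by
          rw [List.take_append, length_alternatingWord, List.take_of_length_le (by simpa)]
        have hprod : cs.wordProd (alternatingWord i j (k + 1) ++
            (c.take (n - k) ++ (alternatingWord i j k ++ c).drop (n + 1))) =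
              cs.wordProd (alternatingWord i j k ++ c) := by
          rw [alternatingWord_succ', List.cons_append, ← List.append_assoc, ← htake, wordProd_cons,
            wordProd_append, ← mul_assoc, e, ← wordProd_append, List.take_append_drop]
        refine ⟨_, hprod.trans hw, hred.of_wordProd_eq hprod ?_⟩
        simp only [length_append, length_alternatingWord, length_take, length_drop] at hn ⊢
        omega
      -- A deletion inside the prefix equates the two alternating words of length `n + 1`, so `M i
      -- j` divides `n + 1 ≤ k`. Reducedness gives `k ≤ M i j`, so the prefix is the braid word.
      · exfalso
        obtain ⟨d, rfl⟩ := Nat.exists_eq_add_of_lt hkn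
        have hprefix : cs.IsReduced (alternatingWord i j (n + d + 1)) := by
          simpa using hred.take (n + d + 1)
        rw [List.take_append_of_le_length (by simp; omega),
          List.take_append_of_le_length (by simp), ← wordProd_cons, ← List.take_succ_cons,
          ← alternatingWord_succ', show n + d + 1 + 1 = (n + 1) + (d + 1) by ring,
          show n + d + 1 = (n + 1) + d by ring, take_alternatingWord_add,
          take_alternatingWord_add] at e
        have hpow : (cs.simple i * cs.simple j) ^ (n + 1) = 1 := by
          apply cs.simple_mul_simple_pow_eq_one_of_wordProd_eq
          by_cases hd : Even d
          · simpa [hd, Nat.even_add_one] using e.symm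
          · simpa [hd, Nat.even_add_one] using e
        have hdvd := cs.dvd_of_simple_mul_simple_pow_eq_one hij hpow
        have hle := Nat.le_of_dvd n.succ_pos hdvd
        have h0 : M i j ≠ 0 := fun h0 ↦ by simp [h0] at hdvd
        have hge : ¬ n + d + 1 > M i j := fun h ↦ cs.not_isReduced_alternatingWord i j h0 h hprefix
        have hk : n + d + 1 = M i j := by omega
        rw [hk] at hw hred
        exact hcon ⟨h0, c, hw, hred⟩
  obtain ⟨c, hw, hred⟩ := key (cs.length w + 1)
  have := hred.eq
  rw [hw] at this
  simp at this
  omega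

theorem IsReduced.isLeftDescent_cons {cs : CoxeterSystem M W} {i : B} {ω : List B}
    (h : cs.IsReduced (i :: ω)) : cs.IsLeftDescent (cs.wordProd (i :: ω)) i := by
  rw [IsLeftDescent, h.eq, wordProd_cons, simple_mul_simple_cancel_left]
  exact Nat.lt_succ_of_le (cs.length_wordProd_le ω)

end CoxeterSystem

namespace ArtinTits

open CoxeterSystem

variable {B : Type*} {M : CoxeterMatrix B}

theorem monoidEval_append (u v : List B) :
    monoidEval M (u ++ v) = monoidEval M u * monoidEval M v := by
  simp [monoidEval]

theorem monoidEval_cons (i : B) (u : List B) :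
    monoidEval M (i :: u) = monoidEval M [i] * monoidEval M u :=
  monoidEval_append [i] u

theorem monoidEval_braidWord {i j : B} (hij : i ≠ j) :
    monoidEval M (braidWord M i j) = monoidEval M (braidWord M j i) :=
  PresentedMonoid.mk_eq_mk_of_rel (.braid i j hij)

/-- Matsumoto's theorem: two reduced words with the same product in the Coxeter group represent the
same element of the Artin-Tits monoid. -/
theorem monoidEval_eq_of_isReduced {W : Type*} [Group W] (cs : CoxeterSystem M W) {u v : List B}
    (hu : cs.IsReduced u) (hv : cs.IsReduced v) (h : cs.wordProd u = cs.wordProd v) :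
    monoidEval M u = monoidEval M v := by
  have hlen : u.length = v.length := by rw [← hu.eq, ← hv.eq, h]
  induction hn : u.length generalizing u v with
  | zero =>
    rw [List.length_eq_zero_iff.mp hn, List.length_eq_zero_iff.mp (hlen.symm.trans hn)]
  | succ n ih =>
    have same_head {a : B} {x y : List B} (hx : cs.IsReduced (a :: x))
        (hy : cs.IsReduced (a :: y)) (e : cs.wordProd (a :: x) = cs.wordProd (a :: y))
        (hxn : (a :: x).length = n + 1) : monoidEval M (a :: x) = monoidEval M (a :: y) := by
      have hlen' : (a :: x).length = (a :: y).length := by rw [← hx.eq, ← hy.eq, e]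
      rw [monoidEval_cons, monoidEval_cons a y]
      congr 1
      refine ih (hx.drop 1) (hy.drop 1) ?_ (by simpa using hlen') (by simpa using hxn)
      simpa [wordProd_cons] using e
    obtain _ | ⟨a, x⟩ := u
    · simp at hn
    obtain _ | ⟨b, y⟩ := v
    · simp at hlen
    rcases eq_or_ne a b with rfl | hab
    · exact same_head hu hv h hn
    -- Both `a` and `b` are left descents, so some reduced word starts with a braid word in them.
    -- The braid relation turns it into one with the other first letter; each is compared with the
    -- given word sharing its head. The parity of `m` tells which is which.
    · obtain ⟨h0, c, hc, hred⟩ := cs.exists_isReduced_braidWord_append hab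
        hu.isLeftDescent_cons (h ▸ hv.isLeftDescent_cons)
      have hc' : cs.wordProd (braidWord M b a ++ c) = cs.wordProd (a :: x) := by
        rw [← hc, wordProd_append, wordProd_append, cs.wordProd_braidWord_eq]
      have hred' : cs.IsReduced (braidWord M b a ++ c) :=
        hred.of_wordProd_eq (hc'.trans hc.symm) (by simp [M.symmetric b a])
      have heval : monoidEval M (braidWord M a b ++ c) = monoidEval M (braidWord M b a ++ c) := by
        rw [monoidEval_append, monoidEval_append, monoidEval_braidWord hab]
      obtain ⟨m, hm⟩ := Nat.exists_eq_succ_of_ne_zero h0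
      have hm' : M b a = m + 1 := by rw [M.symmetric, hm]
      rw [braidWord, hm, Nat.succ_eq_add_one] at hc hred heval
      rw [braidWord, hm'] at hc' hred' heval
      rw [alternatingWord_succ', List.cons_append] at hc hred heval
      rw [alternatingWord_succ', List.cons_append] at hc' hred' heval
      by_cases hp : Even m
      · simp only [hp, if_true] at hc hred heval hc' hred'
        rw [same_head hu hred' hc'.symm hn, ← heval,
          same_head hv hred (h.symm.trans hc.symm) (hlen ▸ hn)]
      · simp only [hp, if_false] at hc hred heval hc' hred'
        rw [same_head hu hred hc.symm hn, heval,
          same_head hv hred' (h.symm.trans hc'.symm) (hlen ▸ hn)]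

end ArtinTits

/-! ### Simple words are reduced -/

namespace ArtinTits

open CoxeterSystem

variable {B : Type*} {M : CoxeterMatrix B}

theorem prod_map_eq_of_monoidEval_eq {N : Type*} [Monoid N] (f : B → N)
    (hf : ∀ i j, i ≠ j → ((braidWord M i j).map f).prod = ((braidWord M j i).map f).prod)
    {u v : List B} (h : monoidEval M u = monoidEval M v) : (u.map f).prod = (v.map f).prod := by
  have hrel : ∀ a b, BraidRel M a b → FreeMonoid.lift f a = FreeMonoid.lift f b := by
    rintro _ _ ⟨i, j, hij⟩
    rw [FreeMonoid.lift_ofList, FreeMonoid.lift_ofList, hf i j hij]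
  rw [← FreeMonoid.lift_ofList, ← FreeMonoid.lift_ofList]
  exact congrArg (PresentedMonoid.lift f hrel) h

theorem wordProd_eq_of_monoidEval_eq {W : Type*} [Group W] (cs : CoxeterSystem M W) {u v : List B}
    (h : monoidEval M u = monoidEval M v) : cs.wordProd u = cs.wordProd v :=
  prod_map_eq_of_monoidEval_eq cs.simple (fun i j _ ↦ cs.wordProd_braidWord_eq i j) h

theorem length_eq_of_monoidEval_eq {u v : List B}
    (h : monoidEval M u = monoidEval M v) : u.length = v.length := by
  simpa [← ofAdd_nsmul] using prod_map_eq_of_monoidEval_eq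
    (fun _ ↦ Multiplicative.ofAdd (1 : ℕ)) (fun i j _ ↦ by simp [M.symmetric i j]) h

theorem IsSimpleWord.isReduced {u : List B} (hu : IsSimpleWord M u) :
    M.toCoxeterSystem.IsReduced u := by
  obtain ⟨d, ⟨w, -, ω, hω, -, rfl⟩, z, hz⟩ := hu
  obtain ⟨z, rfl⟩ := PresentedMonoid.surjective_mk z
  have h : monoidEval M (u ++ z.toList) = monoidEval M ω := by
    rw [hz, monoidEval_append]; rfl
  -- Braid relations preserve length and image in `W`, so `u z` is as reduced as `ω`, and so is its
  -- prefix `u`.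
  have := (hω.of_wordProd_eq (wordProd_eq_of_monoidEval_eq _ h)
    (length_eq_of_monoidEval_eq h)).take u.length
  simpa using this

/-! ### Words in the Artin-Tits group -/

theorem groupEval_append (x y : List (B × Bool)) :
    groupEval M (x ++ y) = groupEval M x * groupEval M y := by
  rw [groupEval, ← FreeGroup.mul_mk, map_mul]; rfl

theorem groupEval_invRev (x : List (B × Bool)) :
    groupEval M (FreeGroup.invRev x) = (groupEval M x)⁻¹ := by
  rw [groupEval, ← FreeGroup.inv_mk, map_inv]; rfl

theorem mk_posWord (u : List B) : FreeGroup.mk (posWord u) = freeGroupEval u := by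
  induction u with
  | nil => rfl
  | cons i u ih =>
    rw [freeGroupEval, List.map_cons, List.prod_cons, ← freeGroupEval, ← ih, FreeGroup.of,
      FreeGroup.mul_mk]
    rfl

theorem groupEval_posWord_eq_of_monoidEval_eq {u v : List B}
    (h : monoidEval M u = monoidEval M v) :
    groupEval M (posWord u) = groupEval M (posWord v) := by
  have key (u : List B) :
      (u.map fun i ↦ (PresentedGroup.of i : ArtinGroup M)).prod = groupEval M (posWord u) := by
    rw [groupEval, mk_posWord, freeGroupEval, map_list_prod, List.map_map]
    rfl
  rw [← key, ← key]
  refine prod_map_eq_of_monoidEval_eq _ (fun i j hij ↦ ?_) h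
  rw [key, key, groupEval, groupEval, mk_posWord, mk_posWord]
  exact PresentedGroup.mk_eq_mk_of_mul_inv_mem ⟨i, j, hij, rfl⟩

/-- The projection of the group onto `W` suffices here; injectivity of the map from the monoid to
the group is not needed. -/
theorem wordProd_eq_of_groupEval_posWord_eq {W : Type*} [Group W] (cs : CoxeterSystem M W)
    {u v : List B} (h : groupEval M (posWord u) = groupEval M (posWord v)) :
    cs.wordProd u = cs.wordProd v := by
  have key (u : List B) : FreeGroup.lift cs.simple (freeGroupEval u) = cs.wordProd u := by
    rw [freeGroupEval, map_list_prod, List.map_map, wordProd]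
    congr 2
    ext1 i
    simp
  have hrel : ∀ r ∈ braidRelators M, FreeGroup.lift cs.simple r = 1 := by
    rintro _ ⟨σ, τ, -, rfl⟩
    rw [map_mul, map_inv, key, key, cs.wordProd_braidWord_eq, mul_inv_cancel]
  rw [← key, ← key, ← mk_posWord, ← mk_posWord]
  exact congrArg (PresentedGroup.toGroup hrel) h

/-- If the first letter of `u` is a left descent of `v`, then `u⁻¹ v` contains a removable pair. -/
theorem containsRemovablePair_of_isLeftDescent {W : Type*} [Group W] (cs : CoxeterSystem M W)
    {i : B} {u v : List B} (hv : cs.IsReduced v) (hi : cs.IsLeftDescent (cs.wordProd v) i) :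
    ContainsRemovablePair M (negPosWord (i :: u) v) := by
  obtain ⟨j, hj, e⟩ := cs.exists_simple_mul_wordProd_take hi
  rw [← wordProd_cons] at e
  -- The word `i v'` is reduced because it has the length and product of the reduced prefix `v' τ`.
  have hred := hv.take (j + 1)
  have heval := groupEval_posWord_eq_of_monoidEval_eq <| monoidEval_eq_of_isReduced cs
    (hred.of_wordProd_eq e (by simp; omega)) hred e
  have hx : (i, false) :: (posWord (v.take j) ++ [(v[j], !false)]) =
      FreeGroup.invRev (posWord [i]) ++ posWord (v.take (j + 1)) := by
    rw [← List.take_concat_get' v j hj]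
    simp only [posWord, List.map_append]
    rfl
  refine ⟨_, ⟨FreeGroup.invRev (posWord u), posWord (v.drop (j + 1)), ?_⟩, i, v[j], false,
    posWord (v.take j), rfl, ?_⟩
  · rw [hx, negPosWord]
    conv_rhs => rw [← List.take_append_drop (j + 1) v]
    simp [posWord, FreeGroup.invRev]
  · rw [WordEquiv, hx, groupEval_append, groupEval_invRev, ← heval, inv_mul_eq_iff_eq_mul,
      ← groupEval_append]
    rfl

end ArtinTits

theorem propositionP {B : Type*} (M : CoxeterMatrix B) [Finite M.Group]
    (u v : List B) (hu : ArtinTits.IsSimpleWord M u) (hv : ArtinTits.IsSimpleWord M v)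
    (hne : ArtinTits.negPosWord u v ≠ [])
    (htriv : ArtinTits.IsTrivialWord M (ArtinTits.negPosWord u v)) :
    ArtinTits.ContainsRemovablePair M (ArtinTits.negPosWord u v) := by
  have hured := hu.isReduced
  have hvred := hv.isReduced
  have heq : M.toCoxeterSystem.wordProd u = M.toCoxeterSystem.wordProd v := by
    apply ArtinTits.wordProd_eq_of_groupEval_posWord_eq
    rw [ArtinTits.IsTrivialWord, ArtinTits.WordEquiv, ArtinTits.negPosWord,
      ArtinTits.groupEval_append, ArtinTits.groupEval_invRev, inv_mul_eq_iff_eq_mul] at htriv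
    rw [htriv, ← ArtinTits.groupEval_append, List.append_nil]
  have hlen : u.length = v.length := by rw [← hured.eq, ← hvred.eq, heq]
  obtain _ | ⟨i, u⟩ := u
  · obtain rfl := List.length_eq_zero_iff.mp hlen.symm
    exact absurd rfl hne
  · exact ArtinTits.containsRemovablePair_of_isLeftDescent M.toCoxeterSystem hvred
      (heq ▸ hured.isLeftDescent_cons)
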